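/- Let $n$ and $w\le n$ be natural numbers. Let $D_1$ be the phase-free $2n$-legged Z-spider. Let $D_2$ be the following ZX diagram of phase-free Z-spiders. It has two central spiders $s_0,s_0'$ and $2w$ further spiders $s_1,\dots,s_w,s_1',\dots,s_w'$; its internal edges are $(s_0,s_i)$, $(s_i,s_i')$, $(s_i',s_0')$ for $1\le i\le w$ (that is, $w$ paths connecting $s_0$ to $s_0'$); and it has $2n$ boundary legs: one at each $s_i$ and each $s_i'$ $(1\le i\le w)$, and $n-w$ at each of $s_0$ and $s_0'$. The boundary legs of $D_1$ and $D_2$ are identified by some bijection, and each of them is designated as an input or an output in an arbitrary way, the same for both diagrams. Then $D_1$ and $D_2$ are $w$-fault-equivalent under edge-flip noise. Here a fault $F$ on a diagram $D$ assigns a Pauli $I,X,Y,Z$, modulo phase, to every edge of $D$ (boundary legs included). Its weight $\mathrm{wt}(F)$ under edge-flip noise is the least number of Paulis acting on a single edge whose product is $F$, and $D^F$ denotes $D$ with these Paulis inserted on the edges. A Pauli web is a Pauli $P_e$ on every edge $e$ of $D$, where $Z$ highlights the edge in green, $X$ in red, and $Y$ in both, such that at each spider with phase $0$ or $\pi$ an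 even number of legs is highlighted in the spider's own colour (green for Z-spiders, red for X-spiders) and all or none of the legs are highlighted in the opposite colour. (For phases $\pm\pi/2$: either an even number of legs in the own colour and none in the opposite one, or an odd number in the own colour and all in the opposite one.) A detecting region is a Pauli web with $P_e=I$ on all input and output edges. A fault is detectable if it anticommutes with some detecting region. Two diagrams $D_1,D_2$ with the same inputs and outputs are $w$-fault-equivalent if for every fault $F_1$ on $D_1$ with $\mathrm{wt}(F_1)<w$, either $F_1$ is detectable, or there is a fault $F_2$ on $D_2$ with $\mathrm{wt}(F_2)\le \mathrm{wt}(F_1)$ such that $D_1^{F_1}$ and $D_2^{F_2}$ denote the same linear map up to a global phase; and the same holds with the roles of $D_1$ and $D_2$ exchanged. -/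

import Mathlib

/-!
Clifford ZX diagrams, Pauli faults on their edges, Pauli webs and detecting regions, and
`w`-fault equivalence, together with the two diagrams of the rewrite.
-/

namespace ZX

/-- The two kinds of spiders: `Z` (green) and `X` (red). -/
inductive Colour
  | Z
  | X

/-- The opposite colour. -/
def Colour.opposite : Colour → Colour
  | Colour.Z => Colour.X
  | Colour.X => Colour.Z

/-- A Clifford ZX diagram with input wires `I` and output wires `O`, as an open graph.

Each edge `e` has two ends `(e, false)` and `(e, true)`; an end is attached to a spider or to an
input or output. Every input and output carries exactly one end. Loops, parallel edges and plain
wires between inputs and outputs are allowed. The phase of the spider `s` is `phase s * (π / 2)`. -/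
structure Diagram (I O : Type) where
  Spider : Type
  Edge : Type
  [fintypeSpider : Fintype Spider]
  [decidableEqSpider : DecidableEq Spider]
  [fintypeEdge : Fintype Edge]
  [decidableEqEdge : DecidableEq Edge]
  colour : Spider → Colour
  phase : Spider → ZMod 4
  endpoint : Edge × Bool → Spider ⊕ (I ⊕ O)
  boundary : ∀ b : I ⊕ O, ∃! h : Edge × Bool, endpoint h = Sum.inr b

attribute [instance] Diagram.fintypeSpider Diagram.decidableEqSpider
  Diagram.fintypeEdge Diagram.decidableEqEdge

/-- Single-qubit Paulis modulo phases, written additively: `(x, z)` is the class of `X ^ x * Z ^ z`,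
so `(0, 0)` is the identity, `(1, 0)` is `X`, `(0, 1)` is `Z` and `(1, 1)` is `Y`. The product of
classes is addition. -/
abbrev Pauli : Type := ZMod 2 × ZMod 2

/-- The matrix `X ^ x * Z ^ z` in the computational basis. -/
def Pauli.toMatrix (p : Pauli) : Matrix (ZMod 2) (ZMod 2) ℂ :=
  Matrix.of fun a b => if a = b + p.1 then (-1 : ℂ) ^ (p.2 * b).val else 0

/-- The coordinate at `a` of the `k`-th basis vector of a colour: `|0⟩, |1⟩` for `Z` and
`|+⟩, |-⟩` for `X`. -/
noncomputable def ket : Colour → ZMod 2 → ZMod 2 → ℂ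
  | Colour.Z, k, a => if a = k then 1 else 0
  | Colour.X, k, a => (-1 : ℂ) ^ (k * a).val / (Real.sqrt 2 : ℂ)

namespace Diagram

variable {I O : Type}

open scoped Classical in
/-- The legs of a spider: the edge ends attached to it (a loop contributes two legs). -/
noncomputable def legs (D : Diagram I O) (s : D.Spider) : Finset (D.Edge × Bool) :=
  Finset.univ.filter fun h => D.endpoint h = Sum.inl s

/-- The tensor `|0…0⟩ + e^{ikπ/2} |1…1⟩` (colour `Z`) or `|+…+⟩ + e^{ikπ/2} |-…-⟩` (colour `X`) of
a spider, evaluated at values `v` of the edge ends. -/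
noncomputable def spiderAmplitude (D : Diagram I O) (s : D.Spider)
    (v : D.Edge × Bool → ZMod 2) : ℂ :=
  (∏ h ∈ D.legs s, ket (D.colour s) 0 (v h)) +
    Complex.I ^ (D.phase s).val * ∏ h ∈ D.legs s, ket (D.colour s) 1 (v h)

/-- A fault assigns to each edge a Pauli modulo phase; faults form an abelian group. -/
abbrev Fault (D : Diagram I O) : Type := D.Edge → Pauli

open scoped Classical in
/-- The linear map from input qubits to output qubits denoted by the diagram `D` with the Pauli
`F e` placed on each edge `e`, in the computational basis. It is the tensor network contraction of
the spiders along the edges, each edge carrying the matrix of its Pauli. (Reading an edge in the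
other direction changes only the sign, when its Pauli is `Y`.) -/
noncomputable def applyFault (D : Diagram I O) (F : D.Fault) :
    Matrix (O → ZMod 2) (I → ZMod 2) ℂ :=
  Matrix.of fun y x => ∑ v : D.Edge × Bool → ZMod 2,
    (if ∀ h b, D.endpoint h = Sum.inr b → v h = Sum.elim x y b then 1 else 0) *
      (∏ s : D.Spider, D.spiderAmplitude s v) *
      ∏ e : D.Edge, (F e).toMatrix (v (e, true)) (v (e, false))

/-! ### Noise models -/

/-- A noise model: a set of atomic faults. -/
abbrev NoiseModel (D : Diagram I O) : Type := Set D.Fault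

/-- The potential faults under a noise model: the group generated by the atomic faults. -/
def NoiseModel.potential {D : Diagram I O} (N : D.NoiseModel) : AddSubgroup D.Fault :=
  AddSubgroup.closure N

/-- The weight of a fault: the minimal number of atomic faults required to generate it. (It is only
used for potential faults; these are sums of atomic faults, as every fault has order at most 2.) -/
noncomputable def NoiseModel.weight {D : Diagram I O} (N : D.NoiseModel) (F : D.Fault) : ℕ :=
  sInf {k | ∃ l : List D.Fault, (∀ A ∈ l, A ∈ N) ∧ l.sum = F ∧ l.length = k}

/-- Edge-flip noise: the atomic faults are the Paulis acting nontrivially on exactly one edge. -/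
def edgeFlip (D : Diagram I O) : D.NoiseModel :=
  {F | ∃! e : D.Edge, F e ≠ 0}

/-! ### Pauli webs and detectability -/

/-- An edge is highlighted in red (`X`) or in green (`Z`), or both, by a Pauli on it. The component
of the given colour is `1` if and only if the edge is highlighted in this colour. -/
def highlight : Colour → Pauli → ZMod 2
  | Colour.X, p => p.1
  | Colour.Z, p => p.2

/-- The number of legs of `s` that `P` highlights in the spider's own colour. -/
noncomputable def ownCount (D : Diagram I O) (P : D.Edge → Pauli) (s : D.Spider) : ℕ :=
  ((D.legs s).filter fun h => highlight (D.colour s) (P h.1) = 1).card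

/-- All legs of `s` are highlighted in the colour opposite to that of `s`. -/
def OppositeAll (D : Diagram I O) (P : D.Edge → Pauli) (s : D.Spider) : Prop :=
  ∀ h ∈ D.legs s, highlight (D.colour s).opposite (P h.1) = 1

/-- No leg of `s` is highlighted in the colour opposite to that of `s`. -/
def OppositeNone (D : Diagram I O) (P : D.Edge → Pauli) (s : D.Spider) : Prop :=
  ∀ h ∈ D.legs s, highlight (D.colour s).opposite (P h.1) = 0

/-- Pauli webs: at a spider with phase `0` or `π`, an even number of legs is highlighted in the
spider's own colour, and all or none in the opposite one; at a spider with phase `±π/2`, either an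
even number in its own colour and none in the opposite one, or an odd number in its own colour and
all in the opposite one. -/
def IsPauliWeb (D : Diagram I O) (P : D.Edge → Pauli) : Prop :=
  ∀ s : D.Spider,
    (Even (D.phase s).val → Even (D.ownCount P s) ∧ (D.OppositeAll P s ∨ D.OppositeNone P s)) ∧
    (Odd (D.phase s).val →
      (Even (D.ownCount P s) ∧ D.OppositeNone P s) ∨ (Odd (D.ownCount P s) ∧ D.OppositeAll P s))

/-- A detecting region is a Pauli web that highlights no input or output edges. -/
def IsDetectingRegion (D : Diagram I O) (P : D.Edge → Pauli) : Prop :=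
  D.IsPauliWeb P ∧
    ∀ (e : D.Edge) (side : Bool) (b : I ⊕ O), D.endpoint (e, side) = Sum.inr b → P e = 0

/-- Two Paulis on the edges anticommute if and only if they have distinct nontrivial components on
an odd number of edges, that is, if their symplectic product is `1`. -/
def Anticommute (D : Diagram I O) (F P : D.Edge → Pauli) : Prop :=
  ∑ e : D.Edge, ((F e).1 * (P e).2 + (F e).2 * (P e).1) = 1

/-- A fault is detectable if it anticommutes with some detecting region. -/
def Detectable (D : Diagram I O) (F : D.Fault) : Prop :=
  ∃ P : D.Edge → Pauli, D.IsDetectingRegion P ∧ D.Anticommute F P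

/-! ### Fault equivalence -/

/-- Equality of linear maps up to a global phase. -/
def EqUpToPhase (A B : Matrix (O → ZMod 2) (I → ZMod 2) ℂ) : Prop :=
  ∃ c : ℂ, ‖c‖ = 1 ∧ A = c • B

/-- One direction of `w`-fault equivalence. -/
def FaultsCovered (w : ℕ) (D₁ : Diagram I O) (N₁ : D₁.NoiseModel)
    (D₂ : Diagram I O) (N₂ : D₂.NoiseModel) : Prop :=
  ∀ F₁ ∈ N₁.potential, N₁.weight F₁ < w →
    D₁.Detectable F₁ ∨
      ∃ F₂ ∈ N₂.potential, N₂.weight F₂ ≤ N₁.weight F₁ ∧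
        EqUpToPhase (D₁.applyFault F₁) (D₂.applyFault F₂)

/-- `D₁` under `N₁` is `w`-fault-equivalent to `D₂` under `N₂`. -/
def WFaultEquivalent (w : ℕ) (D₁ : Diagram I O) (N₁ : D₁.NoiseModel)
    (D₂ : Diagram I O) (N₂ : D₂.NoiseModel) : Prop :=
  FaultsCovered w D₁ N₁ D₂ N₂ ∧ FaultsCovered w D₂ N₂ D₁ N₁

end Diagram

/-- The rewrite `D₁ → D₂` is `w`-fault-equivalent: the diagrams are `w`-fault-equivalent under
edge-flip noise. -/
def IsWFaultEquivalentRewrite {I O : Type} (w : ℕ) (D₁ D₂ : Diagram I O) : Prop :=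
  Diagram.WFaultEquivalent w D₁ D₁.edgeFlip D₂ D₂.edgeFlip

/-! ### The two diagrams -/

/-- The phase-free Z-spider with input legs `I` and output legs `O`. -/
abbrev zSpider (I O : Type) [Fintype I] [Fintype O] [DecidableEq I] [DecidableEq O] :
    Diagram I O where
  Spider := Unit
  Edge := I ⊕ O
  colour _ := Colour.Z
  phase _ := 0
  endpoint
    | (_, false) => Sum.inl ()
    | (b, true) => Sum.inr b
  boundary b := by
    refine ⟨(b, true), rfl, ?_⟩
    rintro ⟨c, _ | _⟩ h
    · simp at h
    · simpa using h

/-- Spiders of the decomposition. There are two halves, `false` and `true`; each has one central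
spider `hub` and `w` outer spiders. -/
inductive FuseSpider (w : ℕ) : Type
  | hub (half : Bool)
  | outer (half : Bool) (i : Fin w)
  deriving DecidableEq, Fintype

/-- Edges of the decomposition: `n` boundary legs for each half, an edge `spoke` from the hub to
each outer spider of the same half, and an edge `rung` between the `i`-th outer spiders of the two
halves. -/
inductive FuseEdge (n w : ℕ) : Type
  | leg (half : Bool) (j : Fin n)
  | spoke (half : Bool) (i : Fin w)
  | rung (i : Fin w)
  deriving DecidableEq, Fintype

/-- The decomposition of the `2n`-legged phase-free Z-spider with `w` connecting paths
`hub false - outer false i - outer true i - hub true`. In each half, the leg `j` is attached to the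
outer spider `j` if `j < w` and to the hub otherwise; for `w ≤ n`, every outer spider thus has three
legs, and each hub has `w` spokes and `n - w` boundary legs. The bijection `e` says which input or
output each of the `2n` boundary legs is. -/
abbrev fuseDiagram {I O : Type} (n w : ℕ) (e : Bool × Fin n ≃ I ⊕ O) : Diagram I O where
  Spider := FuseSpider w
  Edge := FuseEdge n w
  colour _ := Colour.Z
  phase _ := 0
  endpoint
    | (FuseEdge.leg half j, false) =>
        if h : (j : ℕ) < w then Sum.inl (FuseSpider.outer half ⟨j, h⟩)
        else Sum.inl (FuseSpider.hub half)
    | (FuseEdge.leg half j, true) => Sum.inr (e (half, j))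
    | (FuseEdge.spoke half _, false) => Sum.inl (FuseSpider.hub half)
    | (FuseEdge.spoke half i, true) => Sum.inl (FuseSpider.outer half i)
    | (FuseEdge.rung i, false) => Sum.inl (FuseSpider.outer false i)
    | (FuseEdge.rung i, true) => Sum.inl (FuseSpider.outer true i)
  boundary b := by
    refine ⟨(FuseEdge.leg (e.symm b).1 (e.symm b).2, true), by simp, ?_⟩
    rintro ⟨_ | _ | _, _ | _⟩ h
    · dsimp only at h
      split at h <;> simp at h
    · have h' := congrArg e.symm (Sum.inr.inj h)
      rw [Equiv.symm_apply_apply] at h'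
      rw [← h']
    all_goals simp at h

end ZX

/-!
A phase-free Z-spider forces all of its legs to carry the same bit, so a diagram of such spiders
with Paulis on its edges is a sum over one bit per spider, in which the `X`-component of a Pauli
says whether the bits at the two ends of an edge differ and the `Z`-component contributes a sign
(`applyFault_apply_of_phaseFree`). Under edge-flip noise the weight of a fault is the size of its
support (`weight_edgeFlip`).

In the decomposed diagram consider, for each of the `w` paths between the hubs, the parity of the
`X`-components along the path.

* If two paths have different parities, highlighting both of them in green gives a detecting region
  that anticommutes with the fault (`detectable_of_pathParity_ne`).
* If all parities are odd, the fault acts on each of the `w` paths, so that its weight is at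
  least `w` (`le_card_support_of_pathParity`).
* If all parities are even, the bits of all spiders are determined by the bit of one hub: the bit of
  an outer spider differs from it by the `X`-component on its spoke, and the other hub carries the
  same bit. Hence the faulty diagram is, up to a sign, the single spider with the flips of the
  spokes pushed out to the legs `j < w` and with the same total `Z`-parity
  (`applyFault_fuseDiagram`). Flips on legs cost no more than the original flips on legs and spokes,
  and the `Z`-parity can be placed on a leg that is flipped anyway, if there is one
  (`exists_fault_card_support_le`).

Conversely, a fault on the single spider acts in the same way on the legs of the decomposition.
-/

namespace ZX

/-! ### Signs and products of Paulis -/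

lemma neg_one_pow_val_add (a b : ZMod 2) :
    (-1 : ℂ) ^ (a + b).val = (-1) ^ a.val * (-1) ^ b.val := by
  rw [ZMod.val_add, ← pow_add, ← neg_one_pow_eq_pow_mod_two]

lemma neg_one_pow_val_sum {ι : Type*} (s : Finset ι) (f : ι → ZMod 2) :
    (-1 : ℂ) ^ (∑ i ∈ s, f i).val = ∏ i ∈ s, (-1 : ℂ) ^ (f i).val := by
  classical
  induction s using Finset.induction_on with
  | empty => simp
  | insert a s ha ih => rw [Finset.sum_insert ha, Finset.prod_insert ha, neg_one_pow_val_add, ih]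

open scoped Classical in
lemma prod_toMatrix {ι : Type*} [Fintype ι] (F : ι → Pauli) (a b : ι → ZMod 2) :
    ∏ i, (F i).toMatrix (a i) (b i) =
      if ∀ i, a i = b i + (F i).1 then (-1 : ℂ) ^ (∑ i, (F i).2 * b i).val else 0 := by
  split_ifs with h
  · rw [neg_one_pow_val_sum]
    exact Finset.prod_congr rfl fun i _ => by simp [Pauli.toMatrix, h i]
  · push Not at h
    obtain ⟨i, hi⟩ := h
    exact Finset.prod_eq_zero (Finset.mem_univ i) (by simp [Pauli.toMatrix, hi])

namespace Diagram

variable {I O : Type}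

/-! ### Diagrams of phase-free Z-spiders -/

/-- The bit at an edge end, for given bits of the spiders and of the inputs and outputs. -/
def endValue (D : Diagram I O) (t : I ⊕ O → ZMod 2) (k : D.Spider → ZMod 2)
    (h : D.Edge × Bool) : ZMod 2 :=
  Sum.elim k t (D.endpoint h)

lemma spiderAmplitude_of_phaseFree (D : Diagram I O) (s : D.Spider) (hc : D.colour s = Colour.Z)
    (hp : D.phase s = 0) (v : D.Edge × Bool → ZMod 2) :
    D.spiderAmplitude s v = ∑ k : ZMod 2, ∏ h ∈ D.legs s, if v h = k then (1 : ℂ) else 0 := by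
  have h2 : ∀ f : ZMod 2 → ℂ, ∑ k, f k = f 0 + f 1 := fun f => Fin.sum_univ_two f
  simp [spiderAmplitude, hc, hp, ket, h2]

lemma applyFault_apply_of_phaseFree (D : Diagram I O) (hc : ∀ s, D.colour s = Colour.Z)
    (hp : ∀ s, D.phase s = 0) (F : D.Fault) (y : O → ZMod 2) (x : I → ZMod 2) :
    D.applyFault F y x = ∑ k : D.Spider → ZMod 2, ∏ e : D.Edge,
      (F e).toMatrix (D.endValue (Sum.elim x y) k (e, true))
        (D.endValue (Sum.elim x y) k (e, false)) := by
  classical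
  simp only [applyFault, Matrix.of_apply]
  simp_rw [fun s v => spiderAmplitude_of_phaseFree D s (hc s) (hp s) v, Finset.prod_univ_sum,
    Fintype.piFinset_univ, Finset.mul_sum, Finset.sum_mul]
  rw [Finset.sum_comm]
  refine Finset.sum_congr rfl fun k _ => ?_
  rw [Fintype.sum_eq_single (D.endValue (Sum.elim x y) k)]
  · rw [if_pos fun h b hb => by simp [endValue, hb], Finset.prod_eq_one, one_mul, one_mul]
    refine fun s _ => Finset.prod_eq_one fun h hh => if_pos ?_
    simp only [legs, Finset.mem_filter] at hh
    simp [endValue, hh.2]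
  · intro v hv
    obtain ⟨h, hh⟩ := Function.ne_iff.mp hv
    unfold endValue at hh
    rcases hs : D.endpoint h with s | b
    · rw [hs, Sum.elim_inl] at hh
      rw [Finset.prod_eq_zero (Finset.mem_univ s), mul_zero, zero_mul]
      exact Finset.prod_eq_zero (by simpa [legs] using hs) (if_neg hh)
    · rw [hs, Sum.elim_inr] at hh
      rw [if_neg fun H => hh (H h b hs), zero_mul, zero_mul]

/-! ### Edge-flip noise -/

lemma single_mem_edgeFlip (D : Diagram I O) (e : D.Edge) {p : Pauli} (hp : p ≠ 0) :
    (Pi.single e p : D.Fault) ∈ D.edgeFlip := by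
  refine ⟨e, by simpa using hp, fun e' he' => ?_⟩
  by_contra hne
  exact he' (by rw [Pi.single_eq_of_ne hne])

lemma exists_list_edgeFlip (D : Diagram I O) (F : D.Fault) :
    ∃ l : List D.Fault, (∀ A ∈ l, A ∈ D.edgeFlip) ∧ l.sum = F ∧
      l.length = (Finset.univ.filter fun e => F e ≠ 0).card := by
  refine ⟨(Finset.univ.filter fun e => F e ≠ 0).toList.map fun e => Pi.single e (F e), ?_, ?_,
    by simp⟩
  · simp only [List.mem_map, Finset.mem_toList, Finset.mem_filter]
    rintro A ⟨e, he, rfl⟩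
    exact D.single_mem_edgeFlip e he.2
  · rw [Finset.sum_map_toList, Finset.sum_filter_of_ne]
    · exact Finset.univ_sum_single F
    · intro e _ h h0
      exact h (by rw [h0, Pi.single_zero])

lemma mem_potential_edgeFlip (D : Diagram I O) (F : D.Fault) :
    F ∈ NoiseModel.potential D.edgeFlip := by
  obtain ⟨l, hl, rfl, -⟩ := D.exists_list_edgeFlip F
  exact AddSubgroup.list_sum_mem _ fun A hA => AddSubgroup.subset_closure (hl A hA)

lemma card_support_sum_le_length (D : Diagram I O) (l : List D.Fault)
    (hl : ∀ A ∈ l, A ∈ D.edgeFlip) :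
    (Finset.univ.filter fun e => l.sum e ≠ 0).card ≤ l.length := by
  induction l with
  | nil => simp
  | cons A l ih =>
    obtain ⟨e₀, -, he₀⟩ := hl A (by simp)
    have hsub : (Finset.univ.filter fun e => (A :: l).sum e ≠ 0) ⊆
        insert e₀ (Finset.univ.filter fun e => l.sum e ≠ 0) := by
      intro e he
      rw [Finset.mem_insert, Finset.mem_filter]
      by_cases hA : A e = 0
      · exact Or.inr ⟨Finset.mem_univ e, by simpa [hA] using (Finset.mem_filter.mp he).2⟩
      · exact Or.inl (he₀ e hA)
    calc _ ≤ _ := Finset.card_le_card hsub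
      _ ≤ _ := Finset.card_insert_le _ _
      _ ≤ l.length + 1 := Nat.succ_le_succ (ih fun B hB => hl B (by simp [hB]))

lemma weight_edgeFlip (D : Diagram I O) (F : D.Fault) :
    NoiseModel.weight D.edgeFlip F = (Finset.univ.filter fun e => F e ≠ 0).card := by
  refine le_antisymm (Nat.sInf_le (D.exists_list_edgeFlip F)) ?_
  refine le_csInf ⟨_, D.exists_list_edgeFlip F⟩ ?_
  rintro _ ⟨l, hl, rfl, rfl⟩
  exact D.card_support_sum_le_length l hl

lemma cast_ownCount (D : Diagram I O) (P : D.Edge → Pauli) (s : D.Spider) :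
    (D.ownCount P s : ZMod 2) = ∑ h ∈ D.legs s, highlight (D.colour s) (P h.1) := by
  have hbit : ∀ a : ZMod 2, a = if a = 1 then 1 else 0 := by decide
  rw [ownCount, Finset.card_filter, Nat.cast_sum]
  refine Finset.sum_congr rfl fun h _ => ?_
  rw [Nat.cast_ite, Nat.cast_one, Nat.cast_zero]
  exact (hbit _).symm

end Diagram

/-! ### Sums over the edges of the decomposition -/

/-- The edges of the decomposition, sorted into legs, spokes and rungs. -/
def FuseEdge.equivSum (n w : ℕ) :
    FuseEdge n w ≃ (Bool × Fin n) ⊕ (Bool × Fin w) ⊕ Fin w where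
  toFun
    | .leg half j => .inl (half, j)
    | .spoke half i => .inr (.inl (half, i))
    | .rung i => .inr (.inr i)
  invFun
    | .inl p => .leg p.1 p.2
    | .inr (.inl p) => .spoke p.1 p.2
    | .inr (.inr i) => .rung i
  left_inv := by rintro (_ | _ | _) <;> rfl
  right_inv := by rintro (_ | _ | _) <;> rfl

lemma FuseEdge.sum_univ {M : Type*} [AddCommMonoid M] {n w : ℕ} (f : FuseEdge n w → M) :
    ∑ a, f a = (∑ half, ∑ j, f (.leg half j)) +
      ((∑ half, ∑ i, f (.spoke half i)) + ∑ i, f (.rung i)) := by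
  rw [← (FuseEdge.equivSum n w).symm.sum_comp f, Fintype.sum_sum_type, Fintype.sum_sum_type,
    Fintype.sum_prod_type, Fintype.sum_prod_type]
  rfl

/-- The spider to which the end `(a, false)` of an edge `a` is attached. -/
def FuseEdge.source {n w : ℕ} : FuseEdge n w → FuseSpider w
  | .leg half j => if h : (j : ℕ) < w then .outer half ⟨j, h⟩ else .hub half
  | .spoke half _ => .hub half
  | .rung i => .outer false i

/-- The parity of the `X`-components of a fault along the `i`-th path between the hubs. -/
def pathParity {n w : ℕ} (F : FuseEdge n w → Pauli) (i : Fin w) : ZMod 2 :=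
  (F (.spoke false i)).1 + (F (.rung i)).1 + (F (.spoke true i)).1

/-- The difference between the bit of a spider and the bit of the hubs that is forced by a fault
with even `X`-parity along every path. -/
def offset {n w : ℕ} (F : FuseEdge n w → Pauli) : FuseSpider w → ZMod 2
  | .hub _ => 0
  | .outer half i => (F (.spoke half i)).1

/-- Whether a fault with even `X`-parity along every path flips a boundary leg in effect, once the
flips of the spokes are pushed out to the legs. -/
def legFlip {n w : ℕ} (F : FuseEdge n w → Pauli) (q : Bool × Fin n) : ZMod 2 :=
  offset F (FuseEdge.leg q.1 q.2 : FuseEdge n w).source + (F (.leg q.1 q.2)).1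

section

variable {I O : Type} {n w : ℕ} (e : Bool × Fin n ≃ I ⊕ O)

lemma endpoint_source (a : FuseEdge n w) :
    (fuseDiagram n w e).endpoint (a, false) = Sum.inl a.source := by
  rcases a with ⟨half, j⟩ | _ | _
  · by_cases h : (j : ℕ) < w <;> simp [FuseEdge.source, h]
  all_goals rfl

/-! ### The linear maps denoted by the two diagrams -/

open scoped Classical in
lemma applyFault_zSpider [Fintype I] [Fintype O] [DecidableEq I] [DecidableEq O]
    (F : I ⊕ O → Pauli) (y : O → ZMod 2) (x : I → ZMod 2) :
    (zSpider I O).applyFault F y x = ∑ c : ZMod 2,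
      if ∀ b, Sum.elim x y b = c + (F b).1 then (-1 : ℂ) ^ ((∑ b, (F b).2) * c).val else 0 := by
  rw [Diagram.applyFault_apply_of_phaseFree _ (fun _ => rfl) (fun _ => rfl),
    ← (Equiv.funUnique Unit (ZMod 2)).symm.sum_comp]
  refine Finset.sum_congr rfl fun c _ => ?_
  rw [prod_toMatrix, Finset.sum_mul]
  rfl

/-- The equations that a fault imposes on the bits of the spiders and of the boundary: they hold
only if all bits of spiders are determined by that of a hub. -/
lemma fuse_constraints_iff (hw : 0 < w) (F : FuseEdge n w → Pauli) (hF : ∀ i, pathParity F i = 0)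
    (t : I ⊕ O → ZMod 2) (k : FuseSpider w → ZMod 2) :
    (∀ a, (fuseDiagram n w e).endValue t k (a, true) =
        (fuseDiagram n w e).endValue t k (a, false) + (F a).1) ↔
      (∀ s, k s = k (.hub false) + offset F s) ∧
        ∀ q, t (e q) = k (.hub false) + legFlip F q := by
  have hsrc : ∀ a, (fuseDiagram n w e).endValue t k (a, false) = k a.source := fun a => by
    rw [Diagram.endValue, endpoint_source, Sum.elim_inl]
  simp_rw [hsrc]
  have hx : ∀ i, (F (.rung i)).1 = (F (.spoke false i)).1 + (F (.spoke true i)).1 := by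
    have key : ∀ a b c : ZMod 2, a + b + c = 0 → b = a + c := by decide
    exact fun i => key _ _ _ (hF i)
  constructor
  · intro H
    have hs : ∀ half i, k (.outer half i) = k (.hub half) + (F (.spoke half i)).1 :=
      fun half i => H (.spoke half i)
    have hr : ∀ i, k (.outer true i) = k (.outer false i) + (F (.rung i)).1 :=
      fun i => H (.rung i)
    have hhub : ∀ half, k (.hub half) = k (.hub false) := by
      rintro (_ | _)
      · rfl
      · have key : ∀ a b p q : ZMod 2, b + q = a + p + (p + q) → b = a := by decide
        have h1 := hr ⟨0, hw⟩
        rw [hs, hs, hx] at h1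
        exact key _ _ _ _ h1
    have hall : ∀ s, k s = k (.hub false) + offset F s := by
      rintro (half | ⟨half, i⟩)
      · rw [hhub half, offset, add_zero]
      · rw [hs, hhub half, offset]
    refine ⟨hall, fun q => ?_⟩
    have := H (.leg q.1 q.2)
    rw [hall (FuseEdge.source _)] at this
    rw [legFlip, ← add_assoc]
    exact this
  · rintro ⟨hall, ht⟩ (⟨half, j⟩ | ⟨half, i⟩ | i)
    · rw [hall (FuseEdge.source _), add_assoc]
      exact ht (half, j)
    · rw [FuseEdge.source, hall (.hub half), offset, add_zero]
      exact hall (.outer half i)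
    · have key : ∀ c p q : ZMod 2, c + q = c + p + (p + q) := by decide
      rw [FuseEdge.source, hall (.outer false i), hx]
      exact (hall (.outer true i)).trans (key _ _ _)

open scoped Classical in
lemma applyFault_fuseDiagram_apply (hw : 0 < w) (F : FuseEdge n w → Pauli)
    (hF : ∀ i, pathParity F i = 0) (y : O → ZMod 2) (x : I → ZMod 2) :
    (fuseDiagram n w e).applyFault F y x =
      (-1 : ℂ) ^ (∑ a, (F a).2 * offset F a.source).val * ∑ c : ZMod 2,
        if ∀ q, Sum.elim x y (e q) = c + legFlip F q then
          (-1 : ℂ) ^ ((∑ a, (F a).2) * c).val else 0 := by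
  rw [Diagram.applyFault_apply_of_phaseFree _ (fun _ => rfl) (fun _ => rfl), Finset.mul_sum]
  symm
  -- Only the spider bits `c + offset F s` contribute, where `c` is the bit of the hubs.
  refine Finset.sum_of_injOn (fun c s => c + offset F s) ?_ (by simp) ?_ ?_
  · intro c _ c' _ h
    simpa [offset] using congrFun h (.hub false)
  · intro k _ hk
    rw [prod_toMatrix, if_neg]
    intro H
    exact hk ⟨k (.hub false), by simp,
      funext fun s => (((fuse_constraints_iff e hw F hF _ k).mp H).1 s).symm⟩
  · intro c _
    have h0 : c + offset F (.hub false) = c := by rw [offset, add_zero]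
    have hiff := fuse_constraints_iff e hw F hF (Sum.elim x y) fun s => c + offset F s
    simp only [h0, implies_true, true_and] at hiff
    rw [prod_toMatrix]
    simp only [hiff]
    split_ifs with h
    · rw [← neg_one_pow_val_add, Finset.sum_mul, ← Finset.sum_add_distrib]
      congr 2
      refine Finset.sum_congr rfl fun a _ => ?_
      rw [Diagram.endValue, endpoint_source, Sum.elim_inl]
      ring
    · rw [mul_zero]

lemma applyFault_fuseDiagram [Fintype I] [Fintype O] [DecidableEq I] [DecidableEq O]
    (hw : 0 < w) (F : FuseEdge n w → Pauli) (hF : ∀ i, pathParity F i = 0) (G : I ⊕ O → Pauli)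
    (hx : ∀ q, (G (e q)).1 = legFlip F q) (hz : ∑ b, (G b).2 = ∑ a, (F a).2) :
    (fuseDiagram n w e).applyFault F =
      (-1 : ℂ) ^ (∑ a, (F a).2 * offset F a.source).val • (zSpider I O).applyFault G := by
  classical
  ext y x
  rw [applyFault_fuseDiagram_apply e hw F hF, Matrix.smul_apply, applyFault_zSpider, smul_eq_mul,
    hz]
  simp_rw [← e.forall_congr_right, hx]

/-! ### Detectable and undetectable faults on the decomposition -/

/-- The Pauli web that highlights in green the paths with index in `S`. -/
def greenPaths (S : Finset (Fin w)) : FuseEdge n w → Pauli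
  | .leg _ _ => 0
  | .spoke _ i => (0, if i ∈ S then 1 else 0)
  | .rung i => (0, if i ∈ S then 1 else 0)

lemma isDetectingRegion_greenPaths (S : Finset (Fin w)) (hS : Even S.card) :
    (fuseDiagram n w e).IsDetectingRegion (greenPaths S) := by
  classical
  have hx : ∀ a : FuseEdge n w, (greenPaths S a).1 = 0 := by rintro (_ | _ | _) <;> rfl
  refine ⟨fun s => ⟨fun _ => ⟨?_, Or.inr fun h _ => hx h.1⟩, fun h => ?_⟩, ?_⟩
  · rw [← ZMod.natCast_eq_zero_iff_even, Diagram.cast_ownCount, Diagram.legs, Finset.sum_filter,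
      Fintype.sum_prod_type, FuseEdge.sum_univ]
    rcases s with half | ⟨half, i⟩
    · rw [← ZMod.natCast_eq_zero_iff_even] at hS
      cases half <;> simp [greenPaths, Diagram.highlight, hS]
    · cases half <;> simp [greenPaths, Diagram.highlight, CharTwo.add_self_eq_zero]
  · exact absurd h (by simp)
  · rintro (_ | _ | _) (_ | _) b h
    all_goals first | rfl | simp at h

lemma detectable_of_pathParity_ne (F : FuseEdge n w → Pauli) {i j : Fin w}
    (h : pathParity F i ≠ pathParity F j) : (fuseDiagram n w e).Detectable F := by
  have hij : i ≠ j := fun H => h (H ▸ rfl)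
  refine ⟨greenPaths {i, j}, isDetectingRegion_greenPaths e _ ?_, ?_⟩
  · rw [Finset.card_pair hij]
    exact even_two
  · have key : ∀ a b : ZMod 2, a ≠ b → a + b = 1 := by decide
    rw [Diagram.Anticommute, FuseEdge.sum_univ, ← key _ _ h]
    simp only [greenPaths, mul_ite, mul_one, mul_zero, add_zero, Finset.sum_ite_mem,
      Finset.univ_inter, Finset.sum_pair hij, Fintype.sum_bool, pathParity, Prod.fst_zero,
      Prod.snd_zero, Finset.sum_const_zero]
    ring

lemma le_card_support_of_pathParity (F : FuseEdge n w → Pauli) (hF : ∀ i, pathParity F i ≠ 0) :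
    w ≤ (Finset.univ.filter fun a => F a ≠ 0).card := by
  have hex : ∀ i, ∃ a, F a ≠ 0 ∧
      (a = .spoke false i ∨ a = .rung i ∨ a = .spoke true i) := by
    intro i
    by_contra! H
    refine hF i ?_
    have h0 : ∀ a, (a = .spoke false i ∨ a = .rung i ∨ a = .spoke true i) → F a = 0 := by
      intro a ha
      by_contra hne
      have := H a hne
      tauto
    simp [pathParity, h0]
  choose f hf hfi using hex
  have := Finset.card_le_card_of_injOn (s := Finset.univ)
    (t := Finset.univ.filter fun a => F a ≠ 0) f (fun i _ => by simpa using hf i) ?_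
  · simpa using this
  · intro i _ j _ hij
    have hi := hfi i
    have hj := hfi j
    rw [hij] at hi
    rcases hi with hi | hi | hi <;> rcases hj with hj | hj | hj <;> rw [hi] at hj <;> simp_all

lemma card_legFlip_le (F : FuseEdge n w → Pauli) :
    (Finset.univ.filter fun q => legFlip F q ≠ 0).card ≤
      (Finset.univ.filter fun a => F a ≠ 0).card := by
  -- A leg that is flipped in effect carries a fault itself or has one on the spoke next to it.
  have hex : ∀ q, ∃ a : FuseEdge n w, legFlip F q ≠ 0 → F a ≠ 0 ∧
      (a = .leg q.1 q.2 ∨ ∃ h : (q.2 : ℕ) < w, a = .spoke q.1 ⟨q.2, h⟩) := by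
    intro q
    by_cases hl : F (.leg q.1 q.2) = 0
    · by_cases h : (q.2 : ℕ) < w
      · refine ⟨.spoke q.1 ⟨q.2, h⟩, fun hq => ⟨fun h0 => hq ?_, .inr ⟨h, rfl⟩⟩⟩
        simp [legFlip, FuseEdge.source, h, offset, hl, h0]
      · refine ⟨.leg q.1 q.2, fun hq => absurd ?_ hq⟩
        simp [legFlip, FuseEdge.source, h, offset, hl]
    · exact ⟨.leg q.1 q.2, fun _ => ⟨hl, .inl rfl⟩⟩
  choose f hf using hex
  refine Finset.card_le_card_of_injOn f (fun q hq => ?_) ?_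
  · simp only [Finset.coe_filter, Finset.mem_univ, true_and, Set.mem_ofPred_eq] at hq ⊢
    exact (hf q hq).1
  · rintro ⟨b, q⟩ hq ⟨b', q'⟩ hq' heq
    simp only [Finset.coe_filter, Finset.mem_univ, true_and, Set.mem_ofPred_eq] at hq hq'
    have h1 := (hf _ hq).2
    have h2 := (hf _ hq').2
    rw [heq] at h1
    rcases h1 with h1 | ⟨_, h1⟩ <;> rcases h2 with h2 | ⟨_, h2⟩ <;> rw [h1] at h2 <;>
      simp_all [Fin.ext_iff]

/-- The fault on the single spider that has prescribed flips and a prescribed total `Z`-parity need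
not be heavier than a fault on the decomposition with the same effect. -/
lemma exists_fault_card_support_le [Fintype I] [Fintype O] [DecidableEq I] [DecidableEq O]
    (hn : 0 < n) (F : FuseEdge n w → Pauli) :
    ∃ G : I ⊕ O → Pauli, (∀ q, (G (e q)).1 = legFlip F q) ∧ ∑ b, (G b).2 = ∑ a, (F a).2 ∧
      (Finset.univ.filter fun b => G b ≠ 0).card ≤
        (Finset.univ.filter fun a => F a ≠ 0).card := by
  -- The `Z`-parity goes to the leg `q₀`, which is flipped if any leg is.
  obtain ⟨q₀, hq₀⟩ : ∃ q₀, (∃ q, legFlip F q ≠ 0) → legFlip F q₀ ≠ 0 := by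
    by_cases h : ∃ q, legFlip F q ≠ 0
    · exact ⟨h.choose, fun _ => h.choose_spec⟩
    · exact ⟨(false, ⟨0, hn⟩), fun h' => absurd h' h⟩
  refine ⟨fun b => (legFlip F (e.symm b), if b = e q₀ then ∑ a, (F a).2 else 0), by simp,
    by simp, ?_⟩
  by_cases h : ∃ q, legFlip F q ≠ 0
  · refine le_trans (Finset.card_le_card_of_injOn e.symm ?_ e.symm.injective.injOn)
      (card_legFlip_le F)
    intro b hb
    simp only [Finset.coe_filter, Finset.mem_univ, true_and, Set.mem_ofPred_eq] at hb ⊢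
    by_cases hb₀ : b = e q₀
    · simpa [hb₀] using hq₀ h
    · simpa [hb₀, Prod.ext_iff] using hb
  · push Not at h
    by_cases hz : ∑ a, (F a).2 = 0
    · simp [h, hz]
    · have hpos : 0 < (Finset.univ.filter fun a => F a ≠ 0).card := by
        obtain ⟨a, -, ha⟩ := Finset.exists_ne_zero_of_sum_ne_zero hz
        exact Finset.card_pos.mpr ⟨a, by simpa using fun h0 => ha (by rw [h0]; rfl)⟩
      refine le_trans (Finset.card_le_one.mpr fun b hb b' hb' => ?_) hpos
      simp only [h, Finset.mem_filter, Finset.mem_univ, true_and, ne_eq, Prod.mk_eq_zero,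
        ite_eq_right_iff, Classical.not_imp] at hb hb'
      exact hb.1.trans hb'.1.symm

/-! ### Fault equivalence -/

lemma faultsCovered_zSpider_fuseDiagram [Fintype I] [Fintype O] [DecidableEq I] [DecidableEq O]
    (hw : 0 < w) : Diagram.FaultsCovered w (zSpider I O) (zSpider I O).edgeFlip
      (fuseDiagram n w e) (fuseDiagram n w e).edgeFlip := by
  intro G _ _
  let F : FuseEdge n w → Pauli
    | .leg half j => G (e (half, j))
    | .spoke _ _ => 0
    | .rung _ => 0
  have hoff : ∀ s, offset F s = 0 := by rintro (_ | _) <;> rfl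
  refine Or.inr ⟨F, (fuseDiagram n w e).mem_potential_edgeFlip F, ?_, 1, norm_one, ?_⟩
  · rw [Diagram.weight_edgeFlip, Diagram.weight_edgeFlip]
    refine Finset.card_le_card_of_surjOn (fun b => .leg (e.symm b).1 (e.symm b).2) ?_
    rintro (⟨half, j⟩ | _ | _) h
    · exact ⟨e (half, j), by simpa [F] using h, by simp⟩
    all_goals simp [F] at h
  · have hz : ∑ b, (G b).2 = ∑ a, (F a).2 := by
      rw [FuseEdge.sum_univ, ← e.sum_comp, Fintype.sum_prod_type]
      simp [F]
    rw [applyFault_fuseDiagram e hw F (fun i => by simp [pathParity, F]) G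
      (fun q => by simp [legFlip, hoff, F]) hz]
    simp [hoff]

lemma faultsCovered_fuseDiagram_zSpider [Fintype I] [Fintype O] [DecidableEq I] [DecidableEq O]
    (hw : 0 < w) (hwn : w ≤ n) :
    Diagram.FaultsCovered w (fuseDiagram n w e) (fuseDiagram n w e).edgeFlip
      (zSpider I O) (zSpider I O).edgeFlip := by
  intro F _ hlt
  rw [Diagram.weight_edgeFlip] at hlt
  by_cases hne : ∃ i j, pathParity F i ≠ pathParity F j
  · obtain ⟨i, j, hij⟩ := hne
    exact Or.inl (detectable_of_pathParity_ne e F hij)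
  push Not at hne
  have hF : ∀ i, pathParity F i = 0 := by
    intro i
    by_contra hi
    exact absurd (le_card_support_of_pathParity F fun j => hne i j ▸ hi) (not_le.mpr hlt)
  obtain ⟨G, hx, hz, hcard⟩ := exists_fault_card_support_le e (hw.trans_le hwn) F
  refine Or.inr ⟨G, (zSpider I O).mem_potential_edgeFlip G, ?_, _, ?_,
    applyFault_fuseDiagram e hw F hF G hx hz⟩
  · rw [Diagram.weight_edgeFlip, Diagram.weight_edgeFlip]
    exact hcard
  · simp

end

end ZX

theorem mainTheorem3 {I O : Type} [Fintype I] [Fintype O] [DecidableEq I] [DecidableEq O]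
    (n w : ℕ) (hw : w ≤ n) (e : Bool × Fin n ≃ I ⊕ O) :
    ZX.IsWFaultEquivalentRewrite w (ZX.zSpider I O) (ZX.fuseDiagram n w e) := by
  rcases Nat.eq_zero_or_pos w with rfl | hpos
  -- No fault has weight less than `0`.
  · exact ⟨fun _ _ h => absurd h (Nat.not_lt_zero _), fun _ _ h => absurd h (Nat.not_lt_zero _)⟩
  · exact ⟨ZX.faultsCovered_zSpider_fuseDiagram e hpos,
      ZX.faultsCovered_fuseDiagram_zSpider e hpos hw⟩
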